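/- Let $|\cdot|$ be the Euclidean norm on $\mathbb R^n$, let $\mathcal P=\{1,\dots,N\}$, and let $f_i:\mathbb R^n\to\mathbb R^n$, $i\in\mathcal P$, be locally Lipschitz with $f_i(0)=0$. A function $\alpha:[0,\infty)\to[0,\infty)$ is of class $\mathcal K_\infty$ if it is continuous, strictly increasing, unbounded, and $\alpha(0)=0$. Assume that there are $C^1$ functions $V_i:\mathbb R^n\to\mathbb R$ $(i\in\mathcal P)$, functions $\alpha_1,\alpha_2\in\mathcal K_\infty$, a number $\mu>1$ and numbers $\lambda_i\in\mathbb R$ (possibly negative) such that for all $x\in\mathbb R^n$ and $i,j\in\mathcal P$ $$\alpha_1(|x|)\le V_i(x)\le\alpha_2(|x|),\qquad \langle\nabla V_i(x),f_i(x)\rangle\le-\lambda_iV_i(x),\qquad V_i(x)\le\mu V_j(x).$$ Let $\sigma=(\sigma(t))_{t\ge0}$ be a measurable càdlàg process with values in $\mathcal P$ on a probability space $(\Omega,\mathfrak F,\mathsf P)$, with $\sigma(0)=\sigma_0$ deterministic. Let $\tau_0=0$ and let $\tau_1,\tau_2,\dots$ be $[0,\infty)$-valued random variables (the switching instants) such that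 almost surely $\tau_0<\tau_1<\tau_2<\cdots$ and every discontinuity point of $\sigma$ is one of the $\tau_j$ (it is allowed that $\sigma(\tau_j)=\sigma(\tau_{j-1})$). Put $S_j=\tau_j-\tau_{j-1}$, $j\ge1$. Assume that - the $S_j$ are independent and exponentially distributed with parameter $\lambda>0$; - there are $q_i\in[0,1]$, $i\in\mathcal P$, such that $\mathsf P\big(\sigma(\tau_j)=i\mid\sigma(\tau_0),\dots,\sigma(\tau_{j-1})\big)=q_i$ almost surely for all $j\ge1$ and $i\in\mathcal P$; - the sequences $(S_j)_{j\ge1}$ and $(\sigma(\tau_j))_{j\ge0}$ are independent. **Theorem.** If $\lambda_i+\lambda>0$ for all $i\in\mathcal P$ and $$\sum_{i\in\mathcal P}\frac{\mu q_i}{1+\lambda_i/\lambda}<1,$$ then almost surely, for every $x_0\in\mathbb R^n$, the switched system $\dot x(t)=f_{\sigma(t)}(x(t))$, $x(0)=x_0$, has a unique Carathéodory solution $x(\cdot)=x(\cdot\,;x_0)$ on $[0,\infty)$, and the system is globally asymptotically stable almost surely, that is, each of the following two statements holds almost surely: 1. for every $\varepsilon>0$ there is $\delta>0$ such that $\sup_{t\ge0}|x(t;x_0)|<\varepsilon$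 for all $x_0$ with $|x_0|<\delta$; 2. for all $r,\varepsilon'>0$ there is $T\ge0$ such that $\sup_{t\ge T}|x(t;x_0)|<\varepsilon'$ for all $x_0$ with $|x_0|<r$. -/

import Mathlib

open MeasureTheory ProbabilityTheory Filter Topology
open scoped NNReal ENNReal

/-- The state space `ℝⁿ` with the Euclidean norm. -/
abbrev StateSpace (n : ℕ) : Type := EuclideanSpace ℝ (Fin n)

/-- Class `𝒦`: continuous, strictly increasing functions on `[0, ∞)` vanishing at `0`. -/
structure IsClassK (α : ℝ≥0 → ℝ≥0) : Prop where
  continuous : Continuous α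
  map_zero : α 0 = 0
  strictMono : StrictMono α

/-- Class `𝒦_∞`: the unbounded functions of class `𝒦`. -/
structure IsClassKInfty (α : ℝ≥0 → ℝ≥0) : Prop extends IsClassK α where
  tendsto_atTop : Tendsto α atTop atTop

/-- The Lie derivative `L_f V (x) = ⟨∇V(x), f(x)⟩`. -/
noncomputable def lieDerivative {n : ℕ} (f : StateSpace n → StateSpace n)
    (V : StateSpace n → ℝ) (x : StateSpace n) : ℝ :=
  inner ℝ (gradient V x) (f x)

/-- `V₁, …, V_N` are multiple Lyapunov functions for the family of vector fields `f₁, …, f_N`, with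
comparison functions `α₁, α₂`, ratio bound `μ` and (not necessarily positive) decay rates `ℓ i`. -/
structure IsLyapunovFamily {n N : ℕ} (f : Fin N → StateSpace n → StateSpace n)
    (V : Fin N → StateSpace n → ℝ) (α₁ α₂ : ℝ≥0 → ℝ≥0) (μ : ℝ) (ℓ : Fin N → ℝ) : Prop where
  contDiff : ∀ i, ContDiff ℝ 1 (V i)
  classKInfty_lower : IsClassKInfty α₁
  classKInfty_upper : IsClassKInfty α₂
  one_lt : 1 < μ
  lower_le : ∀ i x, (α₁ ‖x‖₊ : ℝ) ≤ V i x
  le_upper : ∀ i x, V i x ≤ (α₂ ‖x‖₊ : ℝ)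
  lieDerivative_le : ∀ i x, lieDerivative (f i) (V i) x ≤ -ℓ i * V i x
  le_mul : ∀ i j x, V i x ≤ μ * V j x

section Signal

variable {Ω : Type*} [MeasurableSpace Ω] {N : ℕ}

/-- `σ` is a measurable càdlàg process with values in `{1, …, N}` (with its discrete topology),
starting at the known value `σ₀`, with switching instants `0 = τ 0 < τ 1 < τ 2 < …`: almost surely
the path of `σ` is continuous (that is, locally constant) away from the switching instants.
At a switching instant the new value may coincide with the old one. -/
structure IsSwitchingSignal (P : Measure Ω) (σ : ℝ≥0 → Ω → Fin N) (σ₀ : Fin N)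
    (τ : ℕ → Ω → ℝ≥0) : Prop where
  measurable_uncurry : Measurable (fun p : ℝ≥0 × Ω => σ p.1 p.2)
  right_continuous : ∀ ω t, ContinuousWithinAt (fun s => σ s ω) (Set.Ici t) t
  left_limit : ∀ ω t, ∃ i, Tendsto (fun s => σ s ω) (𝓝[<] t) (𝓝 i)
  initial : ∀ ω, σ 0 ω = σ₀
  measurable_instant : ∀ j, Measurable (τ j)
  instant_zero : ∀ ω, τ 0 ω = 0
  instant_strictMono : ∀ᵐ ω ∂P, StrictMono (fun j => τ j ω)
  discontinuity : ∀ᵐ ω ∂P, ∀ t, ¬ ContinuousAt (fun s => σ s ω) t → ∃ j, t = τ j ω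

/-- The holding times; `holdingTime τ j = τ (j + 1) - τ j`, for `j = 0, 1, 2, …`. -/
def holdingTime (τ : ℕ → Ω → ℝ≥0) (j : ℕ) (ω : Ω) : ℝ :=
  (τ (j + 1) ω : ℝ) - (τ j ω : ℝ)

/-- The value of the signal at the `j`-th switching instant. -/
def destination (σ : ℝ≥0 → Ω → Fin N) (τ : ℕ → Ω → ℝ≥0) (j : ℕ) (ω : Ω) : Fin N :=
  σ (τ j ω) ω

/-- Switching signals with i.i.d. exponential holding times and memoryless jump destinations. -/
structure IsClassEH (P : Measure Ω) (σ : ℝ≥0 → Ω → Fin N) (σ₀ : Fin N)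
    (τ : ℕ → Ω → ℝ≥0) (rate : ℝ) (q : Fin N → ℝ) : Prop
    extends IsSwitchingSignal P σ σ₀ τ where
  rate_pos : 0 < rate
  holdingTime_indep : iIndepFun (holdingTime τ) P
  holdingTime_law : ∀ j, HasLaw (holdingTime τ j) (expMeasure rate) P
  q_mem : ∀ i, q i ∈ Set.Icc (0 : ℝ) 1
  destination_condProb : ∀ j, 1 ≤ j → ∀ i,
    P⟦destination σ τ j ⁻¹' {i} |
      MeasurableSpace.comap (fun ω (k : Fin j) => destination σ τ k ω) inferInstance⟧
      =ᵐ[P] fun _ => q i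
  indep : IndepFun (fun ω j => holdingTime τ j ω) (fun ω j => destination σ τ j ω) P

end Signal

/-- `x` is a global Carathéodory solution of `ẋ(t) = f_{s(t)}(x(t))`, `x(0) = x₀`, for the switching
path `s`, written as the equivalent integral equation on `[0, ∞)`. -/
structure IsCaratheodorySolution {n N : ℕ} (f : Fin N → StateSpace n → StateSpace n)
    (s : ℝ≥0 → Fin N) (x₀ : StateSpace n) (x : ℝ≥0 → StateSpace n) : Prop where
  continuous : Continuous x
  intervalIntegrable : ∀ t : ℝ≥0,
    IntervalIntegrable (fun r : ℝ => f (s r.toNNReal) (x r.toNNReal)) volume 0 t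
  integral_eq : ∀ t : ℝ≥0,
    x t = x₀ + ∫ r in (0 : ℝ)..t, f (s r.toNNReal) (x r.toNNReal)

/-- Almost surely, for every initial state the switched system has exactly one global solution. -/
def IsWellPosedAS {Ω : Type*} [MeasurableSpace Ω] {n N : ℕ} (P : Measure Ω)
    (f : Fin N → StateSpace n → StateSpace n) (σ : ℝ≥0 → Ω → Fin N) : Prop :=
  ∀ᵐ ω ∂P, ∀ x₀ : StateSpace n, ∃! x, IsCaratheodorySolution f (fun t => σ t ω) x₀ x

/-- Global asymptotic stability almost surely of the switched system `ẋ = f_σ(x)`. The suprema are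
taken in `[0, ∞]`. -/
structure IsGASAlmostSurely {Ω : Type*} [MeasurableSpace Ω] {n N : ℕ} (P : Measure Ω)
    (f : Fin N → StateSpace n → StateSpace n) (σ : ℝ≥0 → Ω → Fin N) : Prop where
  stable : ∀ᵐ ω ∂P, ∀ ε : ℝ, 0 < ε → ∃ δ : ℝ, 0 < δ ∧
    ∀ x₀ x, IsCaratheodorySolution f (fun t => σ t ω) x₀ x →
      ‖x₀‖ < δ → (⨆ t : ℝ≥0, ‖x t‖ₑ) < ENNReal.ofReal ε
  attractive : ∀ᵐ ω ∂P, ∀ r ε : ℝ, 0 < r → 0 < ε → ∃ T : ℝ≥0,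
    ∀ x₀ x, IsCaratheodorySolution f (fun t => σ t ω) x₀ x →
      ‖x₀‖ < r → (⨆ t : ℝ≥0, ⨆ _ : T ≤ t, ‖x t‖ₑ) < ENNReal.ofReal ε

/-! Write `S k` for the holding times, `d k` for the modes visited, and `M j = ∏_{k<j} μ exp(-ℓ (d
k) S k)`, which is `lyapunovFactor`. While mode `d k` is active its Lyapunov function is multiplied
by at most `exp(-ℓ (d k) S k)`, and exchanging it for the next one costs a factor `μ`. Hence `α₁ ‖x
r‖ ≤ (M j + M (j+1)) α₂ ‖x₀‖` on the `j`-th interval (`lower_le_lyapunovFactor_mul`). The factor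
does not involve `x₀`, so both stability statements follow path by path once `M j → 0`: boundedness
of `M` gives stability, and its decay gives attraction uniform over balls.

For a holding time `S`, `E exp(-ℓ i S) = 1 / (1 + ℓ i / rate)`, finite because `ℓ i + rate > 0`.
Since holding times and modes are independent and each new mode has law `q` given the earlier modes,
`E M (j+1)` is a constant times `ρ ^ j`, where `ρ < 1` is the sum in the hypothesis
(`lintegral_lyapunovFactor`). Thus `∑ E M j < ∞`, so `∑ M j < ∞` almost surely, and `M j → 0`.

Well-posedness needs `τ j → ∞`, obtained by the same summation from `E exp(-τ j)`, and the absence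
of blow-up in each mode: `V i` is proper and grows at most exponentially. -/

/-! ### Lyapunov comparison and existence for a single vector field -/

section ODE

variable {E : Type*} [NormedAddCommGroup E] [NormedSpace ℝ E]

/-- Exponential comparison for a Lyapunov function along a curve with one-sided derivatives. -/
theorem lyapunov_le_exp_mul {V : E → ℝ} (hV : ContDiff ℝ 1 V) {y v : ℝ → E} {a b c : ℝ}
    (hy : ContinuousOn y (Set.Icc a b))
    (hd : ∀ t ∈ Set.Ico a b, HasDerivWithinAt y (v t) (Set.Ici t) t)
    (hle : ∀ t ∈ Set.Ico a b, fderiv ℝ V (y t) (v t) ≤ -c * V (y t)) :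
    ∀ t ∈ Set.Icc a b, V (y t) ≤ Real.exp (-c * (t - a)) * V (y a) := by
  have hexp : ∀ t, HasDerivAt (fun t => Real.exp (c * (t - a))) (Real.exp (c * (t - a)) * c) t := by
    intro t
    have h := (((hasDerivAt_id t).sub_const a).const_mul c).exp
    simpa using h
  -- Integrating factor: the product has nonpositive right derivative, so it stays below its initial
  -- value.
  have key : ∀ t ∈ Set.Icc a b, Real.exp (c * (t - a)) * V (y t) ≤ V (y a) := by
    intro t ht
    refine image_le_of_deriv_right_le_deriv_boundary
      (f := fun t => Real.exp (c * (t - a)) * V (y t))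
      (f' := fun t => Real.exp (c * (t - a)) * c * V (y t) +
        Real.exp (c * (t - a)) * fderiv ℝ V (y t) (v t))
      (B := fun _ => V (y a)) (B' := fun _ => 0) ?_ ?_ (by simp) continuousOn_const
      (fun x _ => hasDerivWithinAt_const _ _ _) ?_ ht
    · exact (by fun_prop : Continuous fun t => Real.exp (c * (t - a))).continuousOn.mul
        (hV.continuous.comp_continuousOn hy)
    · intro t ht
      have h1 : HasFDerivAt V (fderiv ℝ V (y t)) (y t) :=
        (hV.differentiable (by simp) _).hasFDerivAt
      exact (hexp t).hasDerivWithinAt.mul (h1.comp_hasDerivWithinAt t (hd t ht))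
    · intro t ht
      have h1 := hle t ht
      have h2 := Real.exp_pos (c * (t - a))
      nlinarith
  intro t ht
  have h1 := key t ht
  have h2 : Real.exp (-c * (t - a)) * Real.exp (c * (t - a)) = 1 := by
    rw [← Real.exp_add]; simp
  calc V (y t) = Real.exp (-c * (t - a)) * (Real.exp (c * (t - a)) * V (y t)) := by
        rw [← mul_assoc, h2, one_mul]
    _ ≤ _ := by gcongr

theorem LocallyLipschitz.smul_real {f : E → E} {φ : E → ℝ} (hφ : LocallyLipschitz φ)
    (hf : LocallyLipschitz f) : LocallyLipschitz fun x => φ x • f x := by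
  have h : LocallyLipschitz fun p : ℝ × E => p.1 • p.2 :=
    (contDiff_smul (𝕜 := ℝ) (n := 1) (F := E)).locallyLipschitz
  exact h.comp (hφ.prodMk hf)

/-- A bounded locally Lipschitz field on a proper space has solutions on every bounded interval. -/
theorem exists_solution_of_bounded [ProperSpace E] {f : E → E} (hf : LocallyLipschitz f) {L : ℝ≥0}
    (hL : ∀ x, ‖f x‖ ≤ L) {a b : ℝ} (hab : a ≤ b) (x₀ : E) :
    ∃ y : ℝ → E, y a = x₀ ∧ ∀ t ∈ Set.Icc a b, HasDerivWithinAt y (f (y t)) (Set.Icc a b) t := by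
  -- With speed at most `L`, a curve travels at most `L * (b - a)`, so Picard–Lindelöf on this ball
  -- covers the whole interval.
  set R : ℝ≥0 := L * ⟨b - a, sub_nonneg.2 hab⟩ with hR
  obtain ⟨K, hK⟩ := LocallyLipschitzOn.exists_lipschitzOnWith_of_compact
    (isCompact_closedBall x₀ R) hf.locallyLipschitzOn
  have hpl : IsPicardLindelof (fun _ => f) (tmin := a) (tmax := b) ⟨a, le_rfl, hab⟩ x₀ R 0 L K :=
    { lipschitzOnWith := fun _ _ => hK
      continuousOn := fun _ _ => continuousOn_const
      norm_le := fun _ _ x _ => hL x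
      mul_max_le := by
        have h : (R : ℝ) = L * (b - a) := rfl
        simp [h, hab] }
  exact hpl.exists_eq_forall_mem_Icc_hasDerivWithinAt₀

/-- A locally Lipschitz field with a proper nonnegative function growing at most exponentially
along trajectories has solutions on every bounded interval. -/
theorem exists_solution_of_lyapunov [ProperSpace E] {f : E → E} (hf : LocallyLipschitz f)
    {V : E → ℝ} (hV : ContDiff ℝ 1 V) (hV0 : ∀ x, 0 ≤ V x) {c : ℝ} (hc : 0 ≤ c)
    (hle : ∀ x, fderiv ℝ V x (f x) ≤ c * V x)
    (hcoer : ∀ C, ∃ R : ℝ, ∀ x, V x ≤ C → ‖x‖ ≤ R) {a b : ℝ} (hab : a ≤ b) (x₀ : E) :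
    ∃ y : ℝ → E, y a = x₀ ∧ ∀ t ∈ Set.Icc a b, HasDerivWithinAt y (f (y t)) (Set.Icc a b) t := by
  obtain ⟨R, hR⟩ := hcoer (Real.exp (c * (b - a)) * V x₀)
  -- The field is cut off outside the ball of radius `R`. The Lyapunov bound keeps the solution of
  -- the truncated equation inside that ball, where the two fields agree.
  set φ : E → ℝ := fun x => max 0 (min 1 (R + 1 - ‖x‖)) with hφ
  have hφ0 : ∀ x, 0 ≤ φ x := fun x => le_max_left _ _
  have hφ1 : ∀ x, φ x ≤ 1 := fun x => max_le zero_le_one (min_le_left _ _)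
  have hφR : ∀ x, ‖x‖ ≤ R → φ x = 1 := by
    intro x hx
    simp only [hφ]
    rw [min_eq_left (by linarith), max_eq_right zero_le_one]
  have hφ2 : ∀ x, R + 1 < ‖x‖ → φ x = 0 := by
    intro x hx
    simp only [hφ]
    exact max_eq_left ((min_le_right _ _).trans (by linarith))
  have hφlip : LocallyLipschitz φ := by
    refine (LocallyLipschitz.const 0).max ((LocallyLipschitz.const 1).min ?_)
    exact ((LipschitzWith.const (R + 1)).sub lipschitzWith_one_norm).locallyLipschitz
  have hg := hφlip.smul_real hf
  obtain ⟨L, hL⟩ : ∃ L : ℝ≥0, ∀ x, ‖φ x • f x‖ ≤ L := by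
    obtain ⟨L, hL⟩ := (isCompact_closedBall (0 : E) (R + 1)).exists_bound_of_continuousOn
      hf.continuous.continuousOn
    refine ⟨⟨max L 0, le_max_right _ _⟩, fun x => ?_⟩
    by_cases hx : ‖x‖ ≤ R + 1
    · rw [norm_smul, Real.norm_of_nonneg (hφ0 x)]
      calc φ x * ‖f x‖ ≤ 1 * ‖f x‖ := by gcongr; exact hφ1 x
        _ ≤ L := by rw [one_mul]; exact hL x (by simpa using hx)
        _ ≤ _ := le_max_left _ _
    · rw [hφ2 x (not_le.1 hx), zero_smul, norm_zero]
      exact le_max_right _ _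
  obtain ⟨y, hy0, hy⟩ := exists_solution_of_bounded hg hL hab x₀
  refine ⟨y, hy0, fun t ht => ?_⟩
  have hb : ∀ t ∈ Set.Icc a b, ‖y t‖ ≤ R := by
    intro t ht
    refine hR _ ?_
    refine (lyapunov_le_exp_mul (c := -c) hV (v := fun t => φ (y t) • f (y t))
      (fun t ht => (hy t ht).continuousWithinAt) ?_ ?_ t ht).trans ?_
    · intro t ht
      exact (hy t (Set.Ico_subset_Icc_self ht)).mono_of_mem_nhdsWithin
        (Icc_mem_nhdsGE_of_mem ht)
    · intro t ht
      -- Scaling the field by `φ ∈ [0, 1]` preserves the growth bound because `c * V` is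
      -- nonnegative.
      rw [map_smul, smul_eq_mul, neg_neg]
      have h1 := hle (y t)
      have h2 : 0 ≤ c * V (y t) := mul_nonneg hc (hV0 _)
      nlinarith [hφ0 (y t), hφ1 (y t)]
    · rw [hy0, neg_neg]
      have := hV0 x₀
      have := ht.2
      gcongr
  have h := hy t ht
  rwa [hφR _ (hb t ht), one_smul] at h

end ODE

/-! ### Carathéodory solutions as curves with right derivatives; uniqueness -/

section Caratheodory

variable {n N : ℕ} {f : Fin N → StateSpace n → StateSpace n} {s : ℝ≥0 → Fin N}
  {x₀ : StateSpace n} {x : ℝ≥0 → StateSpace n}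

theorem IsCaratheodorySolution.initial (hx : IsCaratheodorySolution f s x₀ x) : x 0 = x₀ := by
  simpa using hx.integral_eq 0

/-- A right-continuous path with discrete values is constant just after `t`, so the integrand is
right-continuous and the fundamental theorem of calculus applies at every `t`, switching instants
included. -/
theorem IsCaratheodorySolution.hasDerivWithinAt (hf : ∀ i, Continuous (f i))
    (hs : ∀ t, ContinuousWithinAt s (Set.Ici t) t)
    (hx : IsCaratheodorySolution f s x₀ x) {t : ℝ} (ht : 0 ≤ t) :
    HasDerivWithinAt (fun r : ℝ => x r.toNNReal) (f (s t.toNNReal) (x t.toNNReal))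
      (Set.Ici t) t := by
  set g : ℝ → StateSpace n := fun r => f (s r.toNNReal) (x r.toNNReal) with hg
  have hsev : ∀ᶠ r in 𝓝[≥] t, s r.toNNReal = s t.toNNReal := by
    have h1 : ContinuousWithinAt (fun r : ℝ => s r.toNNReal) (Set.Ici t) t :=
      (hs t.toNNReal).comp continuous_real_toNNReal.continuousWithinAt
        (fun r hr => Real.toNNReal_le_toNNReal hr)
    exact (tendsto_pure.1 (nhds_discrete (Fin N) ▸ h1.tendsto))
  have hcont : ContinuousWithinAt g (Set.Ici t) t := by
    have h1 : ContinuousWithinAt (fun r : ℝ => f (s t.toNNReal) (x r.toNNReal)) (Set.Ici t) t :=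
      ((hf _).comp (hx.continuous.comp continuous_real_toNNReal)).continuousWithinAt
    refine h1.congr_of_eventuallyEq ?_ rfl
    filter_upwards [hsev] with r hr
    simp only [hg, hr]
  have hint : IntervalIntegrable g volume 0 t := by
    simpa [ht] using hx.intervalIntegrable t.toNNReal
  have hmeas : StronglyMeasurableAtFilter g (𝓝[>] t) := by
    have h2 := (hx.intervalIntegrable (t.toNNReal + 1)).1.aestronglyMeasurable
    refine ⟨Set.Ioc 0 (t + 1), ?_, ?_⟩
    · exact Filter.mem_of_superset (Ioc_mem_nhdsGT (show t < t + 1 by linarith))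
        (Set.Ioc_subset_Ioc_left ht)
    · simpa [ht] using h2
  have hD := intervalIntegral.integral_hasDerivWithinAt_right (s := Set.Ici t) (t := Set.Ioi t)
    hint hmeas (hcont.mono Set.Ioi_subset_Ici_self)
  have hD2 := hD.const_add x₀
  refine hD2.congr_of_eventuallyEq_of_mem ?_ Set.self_mem_Ici
  filter_upwards [self_mem_nhdsWithin] with r hr
  have hr0 : 0 ≤ r := ht.trans hr
  simpa [hr0] using hx.integral_eq r.toNNReal

theorem isCaratheodorySolution_of_hasDerivWithinAt (hf : ∀ i, Continuous (f i))
    (hsm : Measurable s) (hc : Continuous x) (h0 : x 0 = x₀)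
    (hd : ∀ t : ℝ, 0 ≤ t → HasDerivWithinAt (fun r : ℝ => x r.toNNReal)
      (f (s t.toNNReal) (x t.toNNReal)) (Set.Ici t) t) :
    IsCaratheodorySolution f s x₀ x := by
  have hX : Continuous fun r : ℝ => x r.toNNReal := hc.comp continuous_real_toNNReal
  have hint : ∀ t : ℝ≥0, IntervalIntegrable
      (fun r : ℝ => f (s r.toNNReal) (x r.toNNReal)) volume 0 t := by
    intro t
    -- The integrand takes one of finitely many continuous values at each time, so the sum of their
    -- norms dominates it.
    have hbound : Continuous fun r : ℝ => ∑ i, ‖f i (x r.toNNReal)‖ :=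
      continuous_finsetSum _ fun i _ => ((hf i).comp hX).norm
    refine (hbound.intervalIntegrable 0 t).mono_fun ?_ ?_
    · have h1 : Measurable fun r : ℝ => f (s r.toNNReal) (x r.toNNReal) := by
        have h2 : Measurable fun p : Fin N × StateSpace n => f p.1 p.2 :=
          measurable_from_prod_countable_right fun i => (hf i).measurable
        exact h2.comp ((hsm.comp measurable_real_toNNReal).prodMk hX.measurable)
      exact h1.aestronglyMeasurable
    · refine ae_of_all _ fun r => ?_
      dsimp only
      rw [Real.norm_of_nonneg (Finset.sum_nonneg fun i _ => norm_nonneg _)]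
      exact Finset.single_le_sum (f := fun i => ‖f i (x r.toNNReal)‖)
        (fun i _ => norm_nonneg _) (Finset.mem_univ (s r.toNNReal))
  refine ⟨hc, hint, fun t => ?_⟩
  have h := intervalIntegral.integral_eq_sub_of_hasDeriv_right hX.continuousOn
    (fun r hr => (hd r ?_).mono Set.Ioi_subset_Ici_self) (hint t)
  · rw [h]; simp [h0]
  · have := hr.1
    rw [min_eq_left t.coe_nonneg] at this
    exact this.le

/-- On `[0, t]` both solutions stay in one compact ball, where `∑ i, K i` is a Lipschitz constant
for every mode; Grönwall uniqueness needs only right derivatives. -/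
theorem IsCaratheodorySolution.unique (hf : ∀ i, LocallyLipschitz (f i))
    (hs : ∀ t, ContinuousWithinAt s (Set.Ici t) t) {y : ℝ≥0 → StateSpace n}
    (hx : IsCaratheodorySolution f s x₀ x) (hy : IsCaratheodorySolution f s x₀ y) : x = y := by
  funext t
  have hX : Continuous fun r : ℝ => x r.toNNReal := hx.continuous.comp continuous_real_toNNReal
  have hY : Continuous fun r : ℝ => y r.toNNReal := hy.continuous.comp continuous_real_toNNReal
  obtain ⟨A, hA⟩ := (isCompact_Icc (a := (0 : ℝ)) (b := t)).exists_bound_of_continuousOn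
    hX.continuousOn
  obtain ⟨B, hB⟩ := (isCompact_Icc (a := (0 : ℝ)) (b := t)).exists_bound_of_continuousOn
    hY.continuousOn
  set S := Metric.closedBall (0 : StateSpace n) (max A B) with hS
  have hK : ∀ i, ∃ K : ℝ≥0, LipschitzOnWith K (f i) S := fun i =>
    ((hf i).locallyLipschitzOn (s := S)).exists_lipschitzOnWith_of_compact
      (isCompact_closedBall _ _)
  choose K hK using hK
  have h := ODE_solution_unique_of_mem_Icc_right (K := ∑ i, K i) (s := fun _ => S)
    (v := fun r => f (s r.toNNReal)) (f := fun r : ℝ => x r.toNNReal)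
    (g := fun r : ℝ => y r.toNNReal) (a := 0) (b := t)
    (fun r _ => (hK _).weaken
      (Finset.single_le_sum (f := K) (fun i _ => zero_le) (Finset.mem_univ (s r.toNNReal))))
    hX.continuousOn
    (fun r hr => hx.hasDerivWithinAt (fun i => (hf i).continuous) hs hr.1)
    (fun r hr => by
      simpa [hS] using Or.inl (hA r (Set.Ico_subset_Icc_self hr)))
    hY.continuousOn
    (fun r hr => hy.hasDerivWithinAt (fun i => (hf i).continuous) hs hr.1)
    (fun r hr => by
      simpa [hS] using Or.inr (hB r (Set.Ico_subset_Icc_self hr)))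
    (by simp [hx.initial, hy.initial])
  simpa using h ⟨t.coe_nonneg, le_rfl⟩

end Caratheodory

/-! ### Switching paths between consecutive instants -/

section Signal

/-- A right-continuous path with discrete values that is continuous away from the instants `t j`
is constant between two consecutive instants. -/
theorem eq_of_mem_Ico_of_continuousAt {N : ℕ} {s : ℝ≥0 → Fin N} {t : ℕ → ℝ≥0}
    (hs : ∀ r, ContinuousWithinAt s (Set.Ici r) r) (ht : StrictMono t)
    (hdisc : ∀ r, ¬ ContinuousAt s r → ∃ j, r = t j) (j : ℕ) :
    ∀ r ∈ Set.Ico (t j) (t (j + 1)), s r = s (t j) := by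
  intro r hr
  have hcont : ContinuousOn s (Set.Ico (t j) (t (j + 1))) := by
    intro u hu
    rcases hu.1.eq_or_lt with rfl | hlt
    · exact (hs _).mono fun v hv => hv.1
    · have : ContinuousAt s u := by
        by_contra hnot
        obtain ⟨k, rfl⟩ := hdisc u hnot
        have h1 := ht.lt_iff_lt.1 hlt
        have h2 := ht.lt_iff_lt.1 hu.2
        omega
      exact this.continuousWithinAt
  exact isPreconnected_Ico.constant hcont hr ⟨le_rfl, ht (Nat.lt_succ_self j)⟩

theorem exists_mem_Ico_of_tendsto_atTop {t : ℕ → ℝ≥0} (h0 : t 0 = 0)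
    (ht : Tendsto t atTop atTop) (r : ℝ≥0) : ∃ j, r ∈ Set.Ico (t j) (t (j + 1)) := by
  classical
  have hex : ∃ k, r < t k := (ht.eventually_gt_atTop r).exists
  have hpos : Nat.find hex ≠ 0 := by
    intro h
    have := Nat.find_spec hex
    rw [h, h0] at this
    exact not_lt_zero this
  obtain ⟨j, hj⟩ := Nat.exists_eq_succ_of_ne_zero hpos
  refine ⟨j, not_lt.1 (Nat.find_min hex (by omega)), ?_⟩
  have := Nat.find_spec hex
  rwa [hj] at this

end Signal

/-! ### Pathwise estimates for the switched system -/

section Switched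

variable {n N : ℕ} {f : Fin N → StateSpace n → StateSpace n} {V : Fin N → StateSpace n → ℝ}
  {α₁ α₂ : ℝ≥0 → ℝ≥0} {μ : ℝ} {ℓ : Fin N → ℝ} {s : ℝ≥0 → Fin N} {t : ℕ → ℝ≥0}
  {x₀ : StateSpace n} {x : ℝ≥0 → StateSpace n}

theorem IsLyapunovFamily.nonneg (hV : IsLyapunovFamily f V α₁ α₂ μ ℓ) (i : Fin N)
    (x : StateSpace n) : 0 ≤ V i x :=
  (NNReal.coe_nonneg _).trans (hV.lower_le i x)

theorem IsLyapunovFamily.fderiv_le (hV : IsLyapunovFamily f V α₁ α₂ μ ℓ) (i : Fin N)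
    (x : StateSpace n) : fderiv ℝ (V i) x (f i x) ≤ -ℓ i * V i x := by
  have h := hV.lieDerivative_le i x
  rwa [lieDerivative, gradient, InnerProductSpace.toDual_symm_apply] at h

theorem IsLyapunovFamily.coercive (hV : IsLyapunovFamily f V α₁ α₂ μ ℓ) (i : Fin N) (C : ℝ) :
    ∃ R : ℝ, ∀ x, V i x ≤ C → ‖x‖ ≤ R := by
  obtain ⟨R, hR⟩ := (hV.classKInfty_lower.tendsto_atTop.eventually_gt_atTop C.toNNReal).exists
  refine ⟨R, fun x hx => ?_⟩
  by_contra hlt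
  have h1 : R < ‖x‖₊ := not_le.1 hlt
  have h2 := hV.classKInfty_lower.strictMono h1
  have h3 : C < α₁ ‖x‖₊ := by
    calc C ≤ C.toNNReal := Real.le_coe_toNNReal C
      _ < α₁ ‖x‖₊ := by exact_mod_cast hR.trans h2
  linarith [hV.lower_le i x]

theorem IsLyapunovFamily.exists_solution (hV : IsLyapunovFamily f V α₁ α₂ μ ℓ)
    (hf : ∀ i, LocallyLipschitz (f i)) (i : Fin N) {a b : ℝ} (hab : a ≤ b) (x₀ : StateSpace n) :
    ∃ y : ℝ → StateSpace n, y a = x₀ ∧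
      ∀ t ∈ Set.Icc a b, HasDerivWithinAt y (f i (y t)) (Set.Icc a b) t := by
  -- The rate `-ℓ i` may be negative; `|ℓ i|` is an admissible nonnegative growth rate.
  refine exists_solution_of_lyapunov (hf i) (hV.contDiff i) (hV.nonneg i) (abs_nonneg (ℓ i))
    (fun x => (hV.fderiv_le i x).trans ?_) (hV.coercive i) hab x₀
  exact mul_le_mul_of_nonneg_right (neg_le_abs _) (hV.nonneg i x)

/-- Solutions of the active modes are concatenated, each starting where the previous one ends;
divergence of the instants makes the pieces cover `[0, ∞)`. -/
theorem IsLyapunovFamily.exists_caratheodorySolution (hV : IsLyapunovFamily f V α₁ α₂ μ ℓ)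
    (hf : ∀ i, LocallyLipschitz (f i)) (hsm : Measurable s) (h0 : t 0 = 0) (ht : StrictMono t)
    (htop : Tendsto t atTop atTop)
    (hconst : ∀ j, ∀ r ∈ Set.Ico (t j) (t (j + 1)), s r = s (t j)) (x₀ : StateSpace n) :
    ∃ x, IsCaratheodorySolution f s x₀ x := by
  have hle : ∀ j, (t j : ℝ) ≤ t (j + 1) := fun j => (ht (Nat.lt_succ_self j)).le
  choose Φ hΦ0 hΦ using fun (j : ℕ) (z : StateSpace n) =>
    hV.exists_solution hf (s (t j)) (hle j) z
  set Z : ℕ → StateSpace n := fun j => Nat.rec x₀ (fun k z => Φ k z (t (k + 1))) j with hZ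
  have hZs : ∀ j, Z (j + 1) = Φ j (Z j) (t (j + 1)) := fun j => rfl
  choose J hJ using exists_mem_Ico_of_tendsto_atTop h0 htop
  have hJuniq : ∀ j r, r ∈ Set.Ico (t j) (t (j + 1)) → J r = j := by
    intro j r hr
    have h1 := ht.lt_iff_lt.1 ((hJ r).1.trans_lt hr.2)
    have h2 := ht.lt_iff_lt.1 (hr.1.trans_lt (hJ r).2)
    omega
  set x : ℝ≥0 → StateSpace n := fun r => Φ (J r) (Z (J r)) r with hx
  have hxeq : ∀ j r, r ∈ Set.Icc (t j) (t (j + 1)) → x r = Φ j (Z j) r := by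
    intro j r hr
    rcases hr.2.eq_or_lt with rfl | hlt
    -- At the right endpoint `x` already follows the next piece, whose initial state `Z (j + 1)` is
    -- the end state of this one.
    · simp only [hx]
      rw [hJuniq (j + 1) _ ⟨le_rfl, ht (Nat.lt_succ_self _)⟩, hΦ0, hZs]
    · simp only [hx]
      rw [hJuniq j r ⟨hr.1, hlt⟩]
  have hcontpiece : ∀ j, ContinuousOn x (Set.Icc (t j) (t (j + 1))) := by
    intro j
    have h1 : ContinuousOn (fun r : ℝ≥0 => Φ j (Z j) r) (Set.Icc (t j) (t (j + 1))) := by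
      have h2 : ContinuousOn (Φ j (Z j)) (Set.Icc (t j : ℝ) (t (j + 1))) :=
        fun r hr => (hΦ j (Z j) r hr).continuousWithinAt
      exact h2.comp NNReal.continuous_coe.continuousOn fun r hr => ⟨hr.1, hr.2⟩
    exact h1.congr (hxeq j)
  have hcontOn : ∀ j, ContinuousOn x (Set.Icc 0 (t j)) := by
    intro j
    induction j with
    | zero => rw [h0, Set.Icc_self]; exact continuousOn_singleton _ _
    | succ k ih =>
      rw [← Set.Icc_union_Icc_eq_Icc (zero_le (a := t k)) (ht (Nat.lt_succ_self k)).le]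
      exact ih.union_of_isClosed (hcontpiece k) isClosed_Icc isClosed_Icc
  have hcont : Continuous x := by
    refine continuous_iff_continuousAt.2 fun r => ?_
    obtain ⟨j, hj⟩ := (htop.eventually_gt_atTop r).exists
    refine (hcontOn j).continuousAt ?_
    filter_upwards [Iio_mem_nhds hj] with u hu
    exact ⟨zero_le, le_of_lt hu⟩
  refine ⟨x, isCaratheodorySolution_of_hasDerivWithinAt (fun i => (hf i).continuous)
    hsm hcont ?_ ?_⟩
  · rw [hxeq 0 0 ⟨h0.le, zero_le⟩]
    have := hΦ0 0 (Z 0)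
    rwa [h0] at this
  · intro r hr
    set j := J r.toNNReal
    have hmem := hJ r.toNNReal
    have hr1 : r ∈ Set.Ico (t j : ℝ) (t (j + 1)) := by
      have h1 : ((r.toNNReal : ℝ≥0) : ℝ) = r := Real.coe_toNNReal r hr
      rw [← h1]
      exact hmem
    have hd := (hΦ j (Z j) r (Set.Ico_subset_Icc_self hr1)).mono_of_mem_nhdsWithin
      (Icc_mem_nhdsGE_of_mem hr1)
    have hval : ∀ u ∈ Set.Icc r (t (j + 1) : ℝ), x u.toNNReal = Φ j (Z j) u := by
      intro u hu
      have hu0 : 0 ≤ u := hr.trans hu.1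
      have h1 : ((u.toNNReal : ℝ≥0) : ℝ) = u := Real.coe_toNNReal u hu0
      have h2 := hxeq j u.toNNReal
        ⟨hmem.1.trans (Real.toNNReal_le_toNNReal hu.1), Real.toNNReal_le_iff_le_coe.2 hu.2⟩
      rw [h2, h1]
    have hr2 := hval r ⟨le_rfl, hr1.2.le⟩
    rw [hconst j _ hmem, hr2]
    refine hd.congr_of_eventuallyEq ?_ hr2
    filter_upwards [Icc_mem_nhdsGE hr1.2] with u hu using hval u hu

/-- The growth factor accumulated by the Lyapunov functions over the first `j` holding times `S`,
when the modes `d` are visited. -/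
noncomputable def lyapunovFactor {N : ℕ} (μ : ℝ) (ℓ : Fin N → ℝ) (S : ℕ → ℝ) (d : ℕ → Fin N)
    (j : ℕ) : ℝ :=
  ∏ k ∈ Finset.range j, μ * Real.exp (-ℓ (d k) * S k)

theorem lyapunovFactor_nonneg (hμ : 0 ≤ μ) (S : ℕ → ℝ) (d : ℕ → Fin N) (j : ℕ) :
    0 ≤ lyapunovFactor μ ℓ S d j :=
  Finset.prod_nonneg fun _ _ => by positivity

/-- The exponential is monotone in `u`, so its maximum is at an endpoint; adding both endpoint
values avoids distinguishing the sign of the rate later. -/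
theorem exp_neg_mul_le_one_add (c : ℝ) {u S : ℝ} (hu : 0 ≤ u) (huS : u ≤ S) :
    Real.exp (-c * u) ≤ 1 + Real.exp (-c * S) := by
  rcases le_total 0 c with hc | hc
  · have : Real.exp (-c * u) ≤ 1 := Real.exp_le_one_iff.2 (by nlinarith)
    linarith [Real.exp_pos (-c * S)]
  · have : Real.exp (-c * u) ≤ Real.exp (-c * S) := Real.exp_le_exp.2 (by nlinarith)
    linarith

theorem IsLyapunovFamily.le_exp_mul (hV : IsLyapunovFamily f V α₁ α₂ μ ℓ)
    (hf : ∀ i, Continuous (f i)) (hs : ∀ r, ContinuousWithinAt s (Set.Ici r) r)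
    (hconst : ∀ j, ∀ r ∈ Set.Ico (t j) (t (j + 1)), s r = s (t j))
    (hx : IsCaratheodorySolution f s x₀ x) (j : ℕ) :
    ∀ r ∈ Set.Icc (t j) (t (j + 1)),
      V (s (t j)) (x r) ≤ Real.exp (-ℓ (s (t j)) * (r - t j)) * V (s (t j)) (x (t j)) := by
  intro r hr
  have h := lyapunov_le_exp_mul (hV.contDiff (s (t j))) (y := fun r : ℝ => x r.toNNReal)
    (v := fun r : ℝ => f (s r.toNNReal) (x r.toNNReal)) (a := t j) (b := t (j + 1))
    (c := ℓ (s (t j))) (hx.continuous.comp continuous_real_toNNReal).continuousOn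
    (fun u hu => hx.hasDerivWithinAt hf hs ((t j).coe_nonneg.trans hu.1)) ?_ r ⟨hr.1, hr.2⟩
  · simpa using h
  · intro u hu
    have hu0 : 0 ≤ u := (t j).coe_nonneg.trans hu.1
    have hmem : u.toNNReal ∈ Set.Ico (t j) (t (j + 1)) := by
      lift u to ℝ≥0 using hu0
      simpa using hu
    rw [hconst j _ hmem]
    exact hV.fderiv_le _ _

theorem IsLyapunovFamily.le_lyapunovFactor_mul (hV : IsLyapunovFamily f V α₁ α₂ μ ℓ)
    (hf : ∀ i, Continuous (f i)) (hs : ∀ r, ContinuousWithinAt s (Set.Ici r) r)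
    (h0 : t 0 = 0) (ht : StrictMono t)
    (hconst : ∀ j, ∀ r ∈ Set.Ico (t j) (t (j + 1)), s r = s (t j))
    (hx : IsCaratheodorySolution f s x₀ x) (j : ℕ) :
    V (s (t j)) (x (t j)) ≤
      lyapunovFactor μ ℓ (fun j => (t (j + 1) : ℝ) - t j) (fun j => s (t j)) j * α₂ ‖x₀‖₊ := by
  have hμ : 0 ≤ μ := zero_le_one.trans hV.one_lt.le
  induction j with
  | zero => simpa [lyapunovFactor, h0, hx.initial] using hV.le_upper (s 0) x₀
  | succ k ih =>
    have h1 := hV.le_exp_mul hf hs hconst hx k (t (k + 1)) ⟨(ht (Nat.lt_succ_self k)).le, le_rfl⟩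
    calc V (s (t (k + 1))) (x (t (k + 1))) ≤ μ * V (s (t k)) (x (t (k + 1))) := hV.le_mul _ _ _
      _ ≤ μ * (Real.exp (-ℓ (s (t k)) * (t (k + 1) - t k)) * V (s (t k)) (x (t k))) := by gcongr
      _ ≤ μ * (Real.exp (-ℓ (s (t k)) * (t (k + 1) - t k)) *
          (lyapunovFactor μ ℓ (fun j => (t (j + 1) : ℝ) - t j) (fun j => s (t j)) k *
            α₂ ‖x₀‖₊)) := by gcongr
      _ = _ := by rw [lyapunovFactor, lyapunovFactor, Finset.prod_range_succ]; ring

theorem IsLyapunovFamily.lower_le_lyapunovFactor_mul (hV : IsLyapunovFamily f V α₁ α₂ μ ℓ)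
    (hf : ∀ i, Continuous (f i)) (hs : ∀ r, ContinuousWithinAt s (Set.Ici r) r)
    (h0 : t 0 = 0) (ht : StrictMono t)
    (hconst : ∀ j, ∀ r ∈ Set.Ico (t j) (t (j + 1)), s r = s (t j))
    (hx : IsCaratheodorySolution f s x₀ x) (j : ℕ) {r : ℝ≥0}
    (hr : r ∈ Set.Icc (t j) (t (j + 1))) :
    (α₁ ‖x r‖₊ : ℝ) ≤
      (lyapunovFactor μ ℓ (fun j => (t (j + 1) : ℝ) - t j) (fun j => s (t j)) j +
        lyapunovFactor μ ℓ (fun j => (t (j + 1) : ℝ) - t j) (fun j => s (t j)) (j + 1)) *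
          α₂ ‖x₀‖₊ := by
  have hμ : 0 ≤ μ := zero_le_one.trans hV.one_lt.le
  set M := lyapunovFactor μ ℓ (fun j => (t (j + 1) : ℝ) - t j) (fun j => s (t j)) with hM
  have hM0 : 0 ≤ M j := lyapunovFactor_nonneg hμ _ _ _
  have hMs : M (j + 1) = M j * (μ * Real.exp (-ℓ (s (t j)) * (t (j + 1) - t j))) := by
    simp only [hM, lyapunovFactor, Finset.prod_range_succ]
  have h1 := hV.le_lyapunovFactor_mul hf hs h0 ht hconst hx j
  have hr1 : (t j : ℝ) ≤ r := hr.1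
  have hr2 : (r : ℝ) ≤ t (j + 1) := hr.2
  have h2 := exp_neg_mul_le_one_add (ℓ (s (t j))) (u := r - t j) (S := t (j + 1) - t j)
    (by linarith) (by linarith)
  set e := Real.exp (-ℓ (s (t j)) * (t (j + 1) - t j)) with he
  have he0 : 0 ≤ e := (Real.exp_pos _).le
  calc (α₁ ‖x r‖₊ : ℝ) ≤ V (s (t j)) (x r) := hV.lower_le _ _
    _ ≤ Real.exp (-ℓ (s (t j)) * (r - t j)) * V (s (t j)) (x (t j)) :=
        hV.le_exp_mul hf hs hconst hx j r hr
    _ ≤ (1 + e) * (M j * α₂ ‖x₀‖₊) := by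
        have := hV.nonneg (s (t j)) (x (t j))
        gcongr
    -- Enlarging `e` to `μ * e` turns the second term into exactly `M (j + 1)`.
    _ ≤ (1 + μ * e) * (M j * α₂ ‖x₀‖₊) := by
        have := hV.one_lt.le
        gcongr
        nlinarith
    _ = _ := by rw [hMs]; ring

theorem iSup_enorm_lt_of_norm_le {E ι : Type*} [NormedAddCommGroup E] {x : ι → E} {p : ι → Prop}
    {ε : ℝ} (hε : 0 < ε) (h : ∀ t, p t → ‖x t‖ ≤ ε / 2) :
    (⨆ t, ⨆ _ : p t, ‖x t‖ₑ) < ENNReal.ofReal ε := by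
  refine lt_of_le_of_lt (iSup₂_le fun t ht => ?_)
    ((ENNReal.ofReal_lt_ofReal_iff hε).2 (half_lt_self hε))
  rw [← ofReal_norm]
  exact ENNReal.ofReal_le_ofReal (h t ht)

theorem IsClassKInfty.norm_le_half {α : ℝ≥0 → ℝ≥0} (hα : IsClassKInfty α) {ε : ℝ}
    {x : StateSpace n} {C : ℝ} (h : (α ‖x‖₊ : ℝ) ≤ C) (hC : C < α (ε / 2).toNNReal) :
    ‖x‖ ≤ ε / 2 := by
  have h1 : α ‖x‖₊ < α (ε / 2).toNNReal := by exact_mod_cast h.trans_lt hC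
  have h2 := hα.strictMono.lt_iff_lt.1 h1
  have h3 := Real.lt_toNNReal_iff_coe_lt.1 h2
  exact h3.le

theorem IsLyapunovFamily.stable_of_tendsto (hV : IsLyapunovFamily f V α₁ α₂ μ ℓ)
    (hf : ∀ i, Continuous (f i)) (hs : ∀ r, ContinuousWithinAt s (Set.Ici r) r)
    (h0 : t 0 = 0) (ht : StrictMono t) (htop : Tendsto t atTop atTop)
    (hconst : ∀ j, ∀ r ∈ Set.Ico (t j) (t (j + 1)), s r = s (t j))
    (hM : Tendsto (lyapunovFactor μ ℓ (fun j => (t (j + 1) : ℝ) - t j) (fun j => s (t j)))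
      atTop (𝓝 0)) {ε : ℝ} (hε : 0 < ε) :
    ∃ δ : ℝ, 0 < δ ∧ ∀ x₀ x, IsCaratheodorySolution f s x₀ x → ‖x₀‖ < δ →
      (⨆ r : ℝ≥0, ‖x r‖ₑ) < ENNReal.ofReal ε := by
  have hμ : 0 ≤ μ := zero_le_one.trans hV.one_lt.le
  set M := lyapunovFactor μ ℓ (fun j => (t (j + 1) : ℝ) - t j) (fun j => s (t j))
  obtain ⟨C, hC⟩ := hM.bddAbove_range
  have hC' : ∀ j, M j ≤ C := fun j => hC ⟨j, rfl⟩
  have hε' : 0 < (ε / 2).toNNReal := Real.toNNReal_pos.2 (half_pos hε)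
  have hα : 0 < (α₁ (ε / 2).toNNReal : ℝ) := by
    have := hV.classKInfty_lower.strictMono hε'
    rw [hV.classKInfty_lower.map_zero] at this
    exact_mod_cast this
  have hlim : Tendsto (fun u : ℝ≥0 => (C + C) * (α₂ u : ℝ)) (𝓝 0) (𝓝 0) := by
    have h1 : Continuous fun u : ℝ≥0 => (C + C) * (α₂ u : ℝ) :=
      continuous_const.mul (NNReal.continuous_coe.comp hV.classKInfty_upper.continuous)
    simpa [hV.classKInfty_upper.map_zero] using h1.tendsto 0
  -- `C` bounds both factors `M j` and `M (j + 1)`; `δ` comes from continuity of `α₂` at `0`.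
  obtain ⟨δ, hδ, hball⟩ := Metric.eventually_nhds_iff.1 (hlim.eventually (gt_mem_nhds hα))
  refine ⟨δ, hδ, fun x₀ x hx hx₀ => ?_⟩
  have h1 := hball (y := ‖x₀‖₊) (by simpa [NNReal.dist_eq] using hx₀)
  have h2 := iSup_enorm_lt_of_norm_le (x := x) (p := fun _ => True) hε fun r _ => by
    obtain ⟨j, hj⟩ := exists_mem_Ico_of_tendsto_atTop h0 htop r
    refine hV.classKInfty_lower.norm_le_half
      ((hV.lower_le_lyapunovFactor_mul hf hs h0 ht hconst hx j
        (Set.Ico_subset_Icc_self hj)).trans ?_) h1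
    gcongr
    · exact hC' j
    · exact hC' (j + 1)
  simpa using h2

theorem IsLyapunovFamily.attractive_of_tendsto (hV : IsLyapunovFamily f V α₁ α₂ μ ℓ)
    (hf : ∀ i, Continuous (f i)) (hs : ∀ r, ContinuousWithinAt s (Set.Ici r) r)
    (h0 : t 0 = 0) (ht : StrictMono t) (htop : Tendsto t atTop atTop)
    (hconst : ∀ j, ∀ r ∈ Set.Ico (t j) (t (j + 1)), s r = s (t j))
    (hM : Tendsto (lyapunovFactor μ ℓ (fun j => (t (j + 1) : ℝ) - t j) (fun j => s (t j)))
      atTop (𝓝 0)) {ρ ε : ℝ} (hε : 0 < ε) :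
    ∃ T : ℝ≥0, ∀ x₀ x, IsCaratheodorySolution f s x₀ x → ‖x₀‖ < ρ →
      (⨆ r : ℝ≥0, ⨆ _ : T ≤ r, ‖x r‖ₑ) < ENNReal.ofReal ε := by
  have hμ : 0 ≤ μ := zero_le_one.trans hV.one_lt.le
  set M := lyapunovFactor μ ℓ (fun j => (t (j + 1) : ℝ) - t j) (fun j => s (t j))
  have hε' : 0 < (ε / 2).toNNReal := Real.toNNReal_pos.2 (half_pos hε)
  have hα : 0 < (α₁ (ε / 2).toNNReal : ℝ) := by
    have := hV.classKInfty_lower.strictMono hε'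
    rw [hV.classKInfty_lower.map_zero] at this
    exact_mod_cast this
  have hlim : Tendsto (fun j => (M j + M (j + 1)) * (α₂ ρ.toNNReal : ℝ)) atTop (𝓝 0) := by
    simpa using (hM.add (hM.comp (tendsto_add_atTop_nat 1))).mul_const (α₂ ρ.toNNReal : ℝ)
  -- `J` depends on the radius `ρ` and not on `x₀`, which makes `T = t J` uniform over the ball.
  obtain ⟨J, hJ⟩ := eventually_atTop.1 (hlim.eventually (gt_mem_nhds hα))
  refine ⟨t J, fun x₀ x hx hx₀ => iSup_enorm_lt_of_norm_le hε fun r hr => ?_⟩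
  obtain ⟨j, hj⟩ := exists_mem_Ico_of_tendsto_atTop h0 htop r
  have hJj : J ≤ j := Nat.lt_succ_iff.1 (ht.lt_iff_lt.1 (hr.trans_lt hj.2))
  refine hV.classKInfty_lower.norm_le_half
    ((hV.lower_le_lyapunovFactor_mul hf hs h0 ht hconst hx j
      (Set.Ico_subset_Icc_self hj)).trans ?_) (hJ j hJj)
  have h1 : 0 ≤ M j := lyapunovFactor_nonneg hμ _ _ _
  have h2 : 0 ≤ M (j + 1) := lyapunovFactor_nonneg hμ _ _ _
  have h3 : ‖x₀‖₊ ≤ ρ.toNNReal := (Real.lt_toNNReal_iff_coe_lt.2 hx₀).le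
  have h4 : (α₂ ‖x₀‖₊ : ℝ) ≤ α₂ ρ.toNNReal := by
    exact_mod_cast hV.classKInfty_upper.strictMono.monotone h3
  gcongr

end Switched

/-! ### Expected growth factors and almost sure convergence -/

section Probability

theorem one_add_div_pos_of_add_pos {c r : ℝ} (hr : 0 < r) (hc : 0 < c + r) : 0 < 1 + c / r := by
  have : 1 + c / r = (c + r) / r := by field_simp; ring
  rw [this]
  exact div_pos hc hr

/-- The moment generating function of the exponential distribution. -/
theorem lintegral_exp_neg_mul_expMeasure {r c : ℝ} (hr : 0 < r) (hc : 0 < c + r) :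
    ∫⁻ s, ENNReal.ofReal (Real.exp (-c * s)) ∂(expMeasure r) =
      ENNReal.ofReal (1 / (1 + c / r)) := by
  have hmeas : Measurable (exponentialPDF r) :=
    (measurable_exponentialPDFReal r).ennreal_ofReal
  have h1 : expMeasure r = volume.withDensity (exponentialPDF r) := rfl
  rw [h1, lintegral_withDensity_eq_lintegral_mul _ hmeas (by fun_prop)]
  -- Exponential tilting: the weighted density of rate `r` is a multiple of the density of rate `c +
  -- r`.
  have h2 : ∀ s, (exponentialPDF r * fun s => ENNReal.ofReal (Real.exp (-c * s))) s =
      ENNReal.ofReal (1 / (1 + c / r)) * exponentialPDF (c + r) s := by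
    intro s
    have hpos := one_add_div_pos_of_add_pos hr hc
    rw [Pi.mul_apply, exponentialPDF_eq, exponentialPDF_eq]
    split_ifs with hs
    · rw [← ENNReal.ofReal_mul (by positivity), ← ENNReal.ofReal_mul (by positivity), mul_assoc,
        ← Real.exp_add]
      congr 1
      have : -(r * s) + -c * s = -((c + r) * s) := by ring
      have hval : 1 / (1 + c / r) * (c + r) = r := by
        rw [div_mul_eq_mul_div, one_mul, div_eq_iff hpos.ne']
        field_simp
        ring
      rw [this, ← mul_assoc, hval]
    · simp
  simp_rw [h2]
  rw [lintegral_const_mul' _ _ ENNReal.ofReal_ne_top, lintegral_exponentialPDF_eq_one hc, mul_one]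

/-- By Tonelli the sum of the variables has finite expectation, hence is almost surely finite, and
the terms of a convergent series vanish in the limit. -/
theorem ae_tendsto_zero_of_summable_lintegral {Ω : Type*} [MeasurableSpace Ω] {P : Measure Ω}
    {X : ℕ → Ω → ℝ} (hX : ∀ j, Measurable (X j)) (hX0 : ∀ j ω, 0 ≤ X j ω) {a : ℕ → ℝ}
    (ha0 : ∀ j, 0 ≤ a j) (ha : Summable a)
    (hle : ∀ j, ∫⁻ ω, ENNReal.ofReal (X j ω) ∂P ≤ ENNReal.ofReal (a j)) :
    ∀ᵐ ω ∂P, Tendsto (fun j => X j ω) atTop (𝓝 0) := by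
  have h1 : ∫⁻ ω, ∑' j, ENNReal.ofReal (X j ω) ∂P ≠ ∞ := by
    rw [lintegral_tsum fun j => (hX j).ennreal_ofReal.aemeasurable]
    refine ne_top_of_le_ne_top ?_ (ENNReal.tsum_le_tsum hle)
    rw [← ENNReal.ofReal_tsum_of_nonneg ha0 ha]
    exact ENNReal.ofReal_ne_top
  filter_upwards [ae_lt_top (Measurable.tsum fun j => (hX j).ennreal_ofReal) h1] with ω hω
  have h2 := ENNReal.tendsto_atTop_zero_of_tsum_ne_top hω.ne
  have h3 := (ENNReal.tendsto_toReal ENNReal.zero_ne_top).comp h2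
  simpa [Function.comp_def, ENNReal.toReal_ofReal (hX0 _ _)] using h3

theorem integral_mul_indicator_of_condProb_eq_const {Ω : Type*} {m mΩ : MeasurableSpace Ω}
    {P : Measure Ω} [IsProbabilityMeasure P] (hle : m ≤ mΩ) {G : Ω → ℝ}
    (hG : StronglyMeasurable[m] G) {C : ℝ} (hC : ∀ ω, ‖G ω‖ ≤ C) {A : Set Ω}
    (hA : MeasurableSet A) {q : ℝ} (hq : P⟦A | m⟧ =ᵐ[P] fun _ => q) :
    Integrable (G * A.indicator fun _ => (1 : ℝ)) P ∧
      ∫ ω, (G * A.indicator fun _ => (1 : ℝ)) ω ∂P = q * ∫ ω, G ω ∂P := by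
  have hind : Integrable (A.indicator fun _ => (1 : ℝ)) P := (integrable_const 1).indicator hA
  have hmul : Integrable (G * A.indicator fun _ => (1 : ℝ)) P :=
    hind.bdd_mul (hG.mono hle).aestronglyMeasurable (ae_of_all _ hC)
  refine ⟨hmul, ?_⟩
  rw [← integral_condExp hle, mul_comm q, ← integral_mul_const]
  refine integral_congr_ae ?_
  filter_upwards [condExp_mul_of_stronglyMeasurable_left hG hmul hind, hq] with ω hω1 hω2
  rw [hω1, Pi.mul_apply]
  exact congrArg (G ω * ·) hω2

variable {Ω : Type*} [MeasurableSpace Ω] {P : Measure Ω} {N : ℕ}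
  {σ : ℝ≥0 → Ω → Fin N} {σ₀ : Fin N} {τ : ℕ → Ω → ℝ≥0} {rate : ℝ} {q : Fin N → ℝ}

theorem IsSwitchingSignal.measurable_destination (hσ : IsSwitchingSignal P σ σ₀ τ) (j : ℕ) :
    Measurable (destination σ τ j) :=
  hσ.measurable_uncurry.comp ((hσ.measurable_instant j).prodMk measurable_id)

theorem IsSwitchingSignal.measurable_holdingTime (hσ : IsSwitchingSignal P σ σ₀ τ) (j : ℕ) :
    Measurable (holdingTime τ j) :=
  (hσ.measurable_instant (j + 1)).coe_nnreal_real.sub (hσ.measurable_instant j).coe_nnreal_real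

theorem IsSwitchingSignal.sum_holdingTime (hσ : IsSwitchingSignal P σ σ₀ τ) (j : ℕ) (ω : Ω) :
    ∑ k ∈ Finset.range j, holdingTime τ k ω = τ j ω := by
  have h := Finset.sum_range_sub (fun k => (τ k ω : ℝ)) j
  simpa [holdingTime, hσ.instant_zero ω] using h

theorem IsClassEH.lintegral_exp_neg_mul (hσ : IsClassEH P σ σ₀ τ rate q) {c : ℝ}
    (hc : 0 < c + rate) (k : ℕ) :
    ∫⁻ ω, ENNReal.ofReal (Real.exp (-c * holdingTime τ k ω)) ∂P =
      ENNReal.ofReal (1 / (1 + c / rate)) := by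
  rw [← lintegral_exp_neg_mul_expMeasure hσ.rate_pos hc, ← (hσ.holdingTime_law k).map_eq,
    lintegral_map (by fun_prop) (hσ.measurable_holdingTime k)]

theorem IsClassEH.lintegral_prod_exp (hσ : IsClassEH P σ σ₀ τ rate q) {c : ℕ → ℝ}
    (hc : ∀ k, 0 < c k + rate) (j : ℕ) :
    ∫⁻ ω, ∏ k ∈ Finset.range j, ENNReal.ofReal (Real.exp (-c k * holdingTime τ k ω)) ∂P =
      ∏ k ∈ Finset.range j, ENNReal.ofReal (1 / (1 + c k / rate)) := by
  have hg : ∀ k, Measurable fun s : ℝ => ENNReal.ofReal (Real.exp (-c k * s)) := fun k => by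
    fun_prop
  rw [lintegral_prod_eq_prod_lintegral_of_indepFun (Finset.range j)
    (fun k ω => ENNReal.ofReal (Real.exp (-c k * holdingTime τ k ω)))
    (hσ.holdingTime_indep.comp _ hg) fun k => (hg k).comp (hσ.measurable_holdingTime k)]
  exact Finset.prod_congr rfl fun k _ => hσ.lintegral_exp_neg_mul (hc k) k

/-- Here `E exp(-τ j) = (1 / (1 + 1 / rate)) ^ j` is summable, so `exp(-τ j) → 0` almost surely. -/
theorem IsClassEH.ae_tendsto_instant (hσ : IsClassEH P σ σ₀ τ rate q) :
    ∀ᵐ ω ∂P, Tendsto (fun j => τ j ω) atTop atTop := by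
  have hr := hσ.rate_pos
  have h1 : 1 / (1 + 1 / rate) < 1 := by
    rw [div_lt_one (by positivity)]
    have : 0 < 1 / rate := by positivity
    linarith
  have key := ae_tendsto_zero_of_summable_lintegral (P := P) (X := fun j ω => Real.exp (-τ j ω))
    (a := fun j => (1 / (1 + 1 / rate)) ^ j)
    (fun j => (hσ.measurable_instant j).coe_nnreal_real.neg.exp) (fun _ _ => (Real.exp_pos _).le)
    (fun j => by positivity) (summable_geometric_of_lt_one (by positivity) h1) fun j => by
      have h2 := hσ.lintegral_prod_exp (c := fun _ => 1) (fun _ => by positivity) j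
      rw [Finset.prod_const, Finset.card_range, ← ENNReal.ofReal_pow (by positivity)] at h2
      rw [← h2]
      refine lintegral_mono fun ω => ?_
      rw [← ENNReal.ofReal_prod_of_nonneg fun _ _ => (Real.exp_pos _).le, ← Real.exp_sum,
        ← Finset.mul_sum, hσ.sum_holdingTime]
      simp
  filter_upwards [key] with ω hω
  rw [← NNReal.tendsto_coe_atTop]
  have h2 : Tendsto (fun j => -(τ j ω : ℝ)) atTop atBot := Real.tendsto_exp_comp_nhds_zero.1 hω
  simpa [Function.comp_def] using tendsto_neg_atBot_atTop.comp h2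

variable [IsProbabilityMeasure P]

/-- Conditioning on the earlier modes splits off one factor `∑ i, q i * h i` per step. The mode at
index `0` is deterministic, whence the separate `h σ₀`. -/
theorem IsClassEH.integral_prod_destination (hσ : IsClassEH P σ σ₀ τ rate q) (h : Fin N → ℝ)
    (j : ℕ) :
    ∫ ω, ∏ k ∈ Finset.range (j + 1), h (destination σ τ k ω) ∂P =
      h σ₀ * (∑ i, q i * h i) ^ j := by
  have hmeas : ∀ k, Measurable fun ω => h (destination σ τ k ω) := fun k =>
    (measurable_of_countable h).comp (hσ.measurable_destination k)
  induction j with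
  | zero => simp [destination, hσ.instant_zero, hσ.initial]
  | succ j ih =>
    set G : Ω → ℝ := fun ω => ∏ k ∈ Finset.range (j + 1), h (destination σ τ k ω) with hG
    have hD : Measurable fun ω (k : Fin (j + 1)) => destination σ τ k ω :=
      measurable_pi_lambda _ fun k : Fin (j + 1) => hσ.measurable_destination k
    have hGm : StronglyMeasurable[MeasurableSpace.comap
        (fun ω (k : Fin (j + 1)) => destination σ τ k ω) inferInstance] G := by
      have h1 : G = (fun d : Fin (j + 1) → Fin N => ∏ k, h (d k)) ∘
          fun ω (k : Fin (j + 1)) => destination σ τ k ω := by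
        funext ω
        simp only [hG, Function.comp, Finset.prod_range]
      rw [h1]
      exact ((measurable_of_countable _).comp (comap_measurable _)).stronglyMeasurable
    have hbdd : ∃ C, ∀ ω, ‖G ω‖ ≤ C := by
      refine ⟨∏ k ∈ Finset.range (j + 1), ∑ i, ‖h i‖, fun ω => ?_⟩
      rw [hG, norm_prod]
      exact Finset.prod_le_prod (fun _ _ => norm_nonneg _) fun k _ =>
        Finset.single_le_sum (f := fun i => ‖h i‖) (fun i _ => norm_nonneg _)
          (Finset.mem_univ (destination σ τ k ω))
    obtain ⟨C, hC⟩ := hbdd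
    have hstep : ∀ i, Integrable
          (G * (destination σ τ (j + 1) ⁻¹' {i}).indicator fun _ => (1 : ℝ)) P ∧
        ∫ ω, (G * (destination σ τ (j + 1) ⁻¹' {i}).indicator fun _ => (1 : ℝ)) ω ∂P =
          q i * ∫ ω, G ω ∂P := fun i =>
      integral_mul_indicator_of_condProb_eq_const hD.comap_le hGm hC
        (hσ.measurable_destination _ (measurableSet_singleton i))
        (hσ.destination_condProb (j + 1) (by omega) i)
    -- The newest factor is split according to the mode reached, to use the conditional
    -- probabilities.
    have hdecomp : ∀ ω, ∏ k ∈ Finset.range (j + 1 + 1), h (destination σ τ k ω) =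
        ∑ i, h i * (G * (destination σ τ (j + 1) ⁻¹' {i}).indicator fun _ => (1 : ℝ)) ω := by
      intro ω
      rw [Finset.prod_range_succ, Finset.sum_eq_single (destination σ τ (j + 1) ω)]
      · simp [hG, mul_comm]
      · intro i _ hi
        simp [Set.indicator, Ne.symm hi]
      · simp
    simp_rw [hdecomp]
    rw [integral_finsetSum _ fun i _ => (hstep i).1.const_mul _]
    simp_rw [integral_const_mul, (hstep _).2, ih]
    rw [pow_succ, Finset.mul_sum, Finset.mul_sum]
    refine Finset.sum_congr rfl fun i _ => ?_
    ring

/-- Independence allows integrating over the holding times with the modes frozen; what remains is a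
product of functions of the modes alone. -/
theorem IsClassEH.lintegral_lyapunovFactor (hσ : IsClassEH P σ σ₀ τ rate q) {μ : ℝ} (hμ : 0 ≤ μ)
    {ℓ : Fin N → ℝ} (h_pos : ∀ i, 0 < ℓ i + rate) (j : ℕ) :
    ∫⁻ ω, ENNReal.ofReal (lyapunovFactor μ ℓ (fun k => holdingTime τ k ω)
        (fun k => destination σ τ k ω) (j + 1)) ∂P =
      ENNReal.ofReal (μ / (1 + ℓ σ₀ / rate) * (∑ i, μ * q i / (1 + ℓ i / rate)) ^ j) := by
  have hS : Measurable fun ω k => holdingTime τ k ω :=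
    measurable_pi_lambda _ hσ.measurable_holdingTime
  have hD : Measurable fun ω k => destination σ τ k ω :=
    measurable_pi_lambda _ hσ.measurable_destination
  have hpos : ∀ i, 0 < 1 + ℓ i / rate := fun i =>
    one_add_div_pos_of_add_pos hσ.rate_pos (h_pos i)
  set F : (ℕ → ℝ) × (ℕ → Fin N) → ℝ≥0∞ :=
    fun p => ENNReal.ofReal (lyapunovFactor μ ℓ p.1 p.2 (j + 1)) with hF
  have hFm : Measurable F := by
    refine Measurable.ennreal_ofReal (Finset.measurable_prod _ fun k _ => ?_)
    have h1 : Measurable fun p : (ℕ → ℝ) × (ℕ → Fin N) => ℓ (p.2 k) :=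
      (measurable_of_countable ℓ).comp ((measurable_pi_apply k).comp measurable_snd)
    have h2 : Measurable fun p : (ℕ → ℝ) × (ℕ → Fin N) => p.1 k :=
      (measurable_pi_apply k).comp measurable_fst
    exact (h1.neg.mul h2).exp.const_mul μ
  have hjoint := (indepFun_iff_map_prod_eq_prod_map_map hS.aemeasurable hD.aemeasurable).1 hσ.indep
  have hinner : ∀ d : ℕ → Fin N, ∫⁻ ω, F (fun k => holdingTime τ k ω, d) ∂P =
      ENNReal.ofReal (∏ k ∈ Finset.range (j + 1), μ * (1 / (1 + ℓ (d k) / rate))) := by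
    intro d
    have h1 := hσ.lintegral_prod_exp (c := fun k => ℓ (d k)) (fun k => h_pos _) (j + 1)
    have h2 : ∀ ω, F (fun k => holdingTime τ k ω, d) = ENNReal.ofReal (μ ^ (j + 1)) *
        ∏ k ∈ Finset.range (j + 1), ENNReal.ofReal (Real.exp (-ℓ (d k) * holdingTime τ k ω)) := by
      intro ω
      rw [← ENNReal.ofReal_prod_of_nonneg fun _ _ => (Real.exp_pos _).le,
        ← ENNReal.ofReal_mul (by positivity)]
      simp only [hF, lyapunovFactor]
      rw [Finset.prod_mul_distrib, Finset.prod_const, Finset.card_range]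
    simp_rw [h2]
    rw [lintegral_const_mul' _ _ ENNReal.ofReal_ne_top, h1,
      ← ENNReal.ofReal_prod_of_nonneg fun _ _ => (one_div_pos.2 (hpos _)).le,
      ← ENNReal.ofReal_mul (by positivity), Finset.prod_mul_distrib, Finset.prod_const,
      Finset.card_range]
  have hlhs : ∫⁻ ω, F (fun k => holdingTime τ k ω, fun k => destination σ τ k ω) ∂P =
      ∫⁻ ω', ∫⁻ ω, F (fun k => holdingTime τ k ω, fun k => destination σ τ k ω') ∂P ∂P := by
    have := Measure.isProbabilityMeasure_map (μ := P) hS.aemeasurable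
    have := Measure.isProbabilityMeasure_map (μ := P) hD.aemeasurable
    rw [← lintegral_map hFm (hS.prodMk hD), hjoint, lintegral_prod_symm' _ hFm,
      lintegral_map hFm.lintegral_prod_left' hD]
    refine lintegral_congr fun ω' => ?_
    exact lintegral_map (hFm.comp (measurable_id.prodMk measurable_const)) hS
  change ∫⁻ ω, F (fun k => holdingTime τ k ω, fun k => destination σ τ k ω) ∂P = _
  rw [hlhs]
  simp_rw [hinner]
  have hnn : ∀ i, 0 ≤ μ * (1 / (1 + ℓ i / rate)) := fun i =>
    mul_nonneg hμ (one_div_pos.2 (hpos i)).le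
  have hval := hσ.integral_prod_destination (fun i => μ * (1 / (1 + ℓ i / rate))) j
  rw [← ofReal_integral_eq_lintegral_ofReal, hval]
  · congr 2
    · ring
    · congr 1
      refine Finset.sum_congr rfl fun i _ => ?_
      ring
  · refine Integrable.of_bound (C := ∏ k ∈ Finset.range (j + 1),
      ∑ i, ‖μ * (1 / (1 + ℓ i / rate))‖) ?_ (ae_of_all _ fun ω => ?_)
    · exact (Finset.measurable_prod _ fun k _ =>
        (measurable_of_countable fun i => μ * (1 / (1 + ℓ i / rate))).comp
          (hσ.measurable_destination k)).aestronglyMeasurable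
    · rw [norm_prod]
      exact Finset.prod_le_prod (fun _ _ => norm_nonneg _) fun k _ =>
        Finset.single_le_sum (f := fun i => ‖μ * (1 / (1 + ℓ i / rate))‖)
          (fun i _ => norm_nonneg _) (Finset.mem_univ (destination σ τ k ω))
  · exact ae_of_all _ fun ω => Finset.prod_nonneg fun k _ => hnn _

theorem IsClassEH.ae_tendsto_lyapunovFactor (hσ : IsClassEH P σ σ₀ τ rate q) {μ : ℝ} (hμ : 0 ≤ μ)
    {ℓ : Fin N → ℝ} (h_pos : ∀ i, 0 < ℓ i + rate)
    (h_contr : ∑ i, μ * q i / (1 + ℓ i / rate) < 1) :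
    ∀ᵐ ω ∂P, Tendsto (lyapunovFactor μ ℓ (fun k => holdingTime τ k ω)
      (fun k => destination σ τ k ω)) atTop (𝓝 0) := by
  have hpos : ∀ i, 0 < 1 + ℓ i / rate := fun i =>
    one_add_div_pos_of_add_pos hσ.rate_pos (h_pos i)
  have hρ : 0 ≤ ∑ i, μ * q i / (1 + ℓ i / rate) := Finset.sum_nonneg fun i _ =>
    div_nonneg (mul_nonneg hμ (hσ.q_mem i).1) (hpos i).le
  have hmeas : ∀ j, Measurable fun ω => lyapunovFactor μ ℓ (fun k => holdingTime τ k ω)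
      (fun k => destination σ τ k ω) (j + 1) := fun j =>
    Finset.measurable_prod _ fun k _ =>
      (((measurable_of_countable ℓ).comp (hσ.measurable_destination k)).neg.mul
        (hσ.measurable_holdingTime k)).exp.const_mul μ
  have key := ae_tendsto_zero_of_summable_lintegral (P := P) hmeas
    (fun j ω => lyapunovFactor_nonneg hμ _ _ _)
    (a := fun j => μ / (1 + ℓ σ₀ / rate) * (∑ i, μ * q i / (1 + ℓ i / rate)) ^ j)
    (fun j => mul_nonneg (div_nonneg hμ (hpos _).le) (pow_nonneg hρ j))
    ((summable_geometric_of_lt_one hρ h_contr).mul_left _)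
    fun j => (hσ.lintegral_lyapunovFactor hμ h_pos j).le
  filter_upwards [key] with ω hω
  -- The expectation formula starts at index `1`; a shift does not affect the limit.
  exact (tendsto_add_atTop_iff_nat 1).1 hω

end Probability

/-! ### Assembly on a set of full measure independent of the initial state -/

theorem mainTheorem1 {Ω : Type*} [MeasurableSpace Ω] (P : Measure Ω) [IsProbabilityMeasure P]
    {n N : ℕ} (f : Fin N → StateSpace n → StateSpace n)
    (hf_lip : ∀ i, LocallyLipschitz (f i)) (hf_zero : ∀ i, f i 0 = 0)
    (V : Fin N → StateSpace n → ℝ) (α₁ α₂ : ℝ≥0 → ℝ≥0) (μ : ℝ) (ℓ : Fin N → ℝ)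
    (hV : IsLyapunovFamily f V α₁ α₂ μ ℓ)
    (σ : ℝ≥0 → Ω → Fin N) (σ₀ : Fin N) (τ : ℕ → Ω → ℝ≥0) (rate : ℝ) (q : Fin N → ℝ)
    (hσ : IsClassEH P σ σ₀ τ rate q)
    (h_pos : ∀ i, 0 < ℓ i + rate)
    (h_contr : ∑ i, μ * q i / (1 + ℓ i / rate) < 1) :
    IsWellPosedAS P f σ ∧ IsGASAlmostSurely P f σ := by
  have hμ : 0 ≤ μ := zero_le_one.trans hV.one_lt.le
  have hfc : ∀ i, Continuous (f i) := fun i => (hf_lip i).continuous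
  have htop := hσ.ae_tendsto_instant
  have hM := hσ.ae_tendsto_lyapunovFactor hμ h_pos h_contr
  refine ⟨?_, ?_, ?_⟩
  · filter_upwards [htop, hσ.instant_strictMono, hσ.discontinuity] with ω htω hmono hdisc x₀
    have hs := hσ.right_continuous ω
    obtain ⟨x, hx⟩ := hV.exists_caratheodorySolution hf_lip
      (hσ.measurable_uncurry.comp measurable_prodMk_right) (hσ.instant_zero ω) hmono htω
      (eq_of_mem_Ico_of_continuousAt hs hmono hdisc) x₀
    exact ⟨x, hx, fun y hy => hy.unique hf_lip hs hx⟩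
  · filter_upwards [htop, hσ.instant_strictMono, hσ.discontinuity, hM] with
      ω htω hmono hdisc hMω ε hε
    have hs := hσ.right_continuous ω
    exact hV.stable_of_tendsto hfc hs (hσ.instant_zero ω) hmono htω
      (eq_of_mem_Ico_of_continuousAt hs hmono hdisc) hMω hε
  · filter_upwards [htop, hσ.instant_strictMono, hσ.discontinuity, hM] with
      ω htω hmono hdisc hMω ρ ε _ hε
    have hs := hσ.right_continuous ω
    exact hV.attractive_of_tendsto hfc hs (hσ.instant_zero ω) hmono htω
      (eq_of_mem_Ico_of_continuousAt hs hmono hdisc) hMω hε
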